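/- Let $n\ge 2$, let $A_n=\{a_1,\dots,a_n\}$ be an alphabet and $A_n^*$ the free monoid of finite strings over it. A right ideal of $A_n^*$ is finitely generated if it has the form $XA_n^*$ with $X$ finite; a morphism between right ideals is a function $\theta$ with $\theta(rs)=\theta(r)s$. Let $M_n$ be the monoid, under composition of partial functions, of all surjective morphisms between finitely generated right ideals of $A_n^*$ together with the empty function $0$. For $a\in M_n$ let $a^*$ be the identity function on the domain of $a$, and write $a\le b$ if $a=ba^*$. Write $a\equiv b$ if for every $0\ne x\le a$ there is $z\neq 0$ with $z\le x$ and $z\le b$, and for every $0\ne y\le b$ there is $z\ne 0$ with $z\le y$ and $z\le a$. Then $\equiv$ is a congruence, compatible with $a\mapsto a^*$; put $\mathscr C_n=M_n/{\equiv}$ and let $\mathscr T_n=\{c\in\mathscr C_n : c^*=1\}$ be its submonoid of total maps. An $n$-ary Cantor algebra is a set with unary operations $\alpha_1,\dots,\alpha_n$ and an $n$-ary operation $\lambda$, written on the right, satisfying $(x\alpha_1,\dots,x\alpha_n)\lambda=x$ and $(x_1,\dots,x_n)\lambda\alpha_i=x_i$. The monoid $\mathscr T_n$ is an $n$-ary Cantor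 algebra under $[f]\alpha_i=[f\rho_i]$, where $\rho_i(w)=a_iw$, and $([f_1],\dots,[f_n])\lambda=[f]$, where $f(a_iu)=f_i(u)$ for $u$ in the domain of $f_i$ $(1\le i\le n)$ and $f$ is undefined elsewhere. An automorphism is a bijection that preserves $\alpha_1,\dots,\alpha_n$ and $\lambda$; automorphisms form a group under composition. Let $D_n\subseteq M_n$ be the inverse monoid of all bijective morphisms between finitely generated right ideals. A nonzero idempotent $e\in D_n$ is essential if $ef\ne0$ for every nonzero idempotent $f\in D_n$. Let $D_n^e$ be the inverse monoid of all $a\in D_n$ such that $a^{-1}a$ and $aa^{-1}$ are essential, ordered by $c\le a$ if $c=ac^{-1}c$. The Thompson group is $G_{n,1}=D_n^e/\sigma$, where $a\,\sigma\,b$ if there is $c\in D_n^e$ with $c\le a$ and $c\le b$. Then: 1. There is a group isomorphism $\Phi$ from $G_{n,1}$ onto the automorphism group of the $n$-ary Cantor algebra $\mathscr T_n$; it can be chosen so that the class of $d\in D_n^e$ in $G_{n,1}$ acts by left multiplication by the $\equiv$-class $[d]\in\mathscr T_n$, that is, $\Phi(\sigma(d))(f)=[d]f$ for all $f\in\mathscr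 T_n$. 2. For every unit $g$ of the monoid $\mathscr T_n$, left multiplication $f\mapsto gf$ is an automorphism of the $n$-ary Cantor algebra $\mathscr T_n$. 3. Conversely, every automorphism of the $n$-ary Cantor algebra $\mathscr T_n$ is of the form $f\mapsto gf$ for some unit $g$ of $\mathscr T_n$. -/

import Mathlib

noncomputable section

namespace CantorThompson

/-- Finite strings over the alphabet `A_n = Fin n`: the free monoid. -/
abbrev Str (n : ℕ) : Type := FreeMonoid (Fin n)

/-- The right ideal `X A_n^*` generated by a set `X` of strings. -/
def rightIdeal {n : ℕ} (X : Set (Str n)) : Set (Str n) := {w | ∃ x ∈ X, ∃ u, w = x * u}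

/-- Finitely generated right ideals of the free monoid (the empty one is allowed). -/
def IsFGRightIdeal {n : ℕ} (R : Set (Str n)) : Prop :=
  ∃ X : Set (Str n), X.Finite ∧ R = rightIdeal X

theorem IsFGRightIdeal.empty {n : ℕ} : IsFGRightIdeal (∅ : Set (Str n)) :=
  ⟨∅, Set.finite_empty, by simp [rightIdeal]⟩

theorem IsFGRightIdeal.univ {n : ℕ} : IsFGRightIdeal (Set.univ : Set (Str n)) :=
  ⟨{1}, Set.finite_singleton _, by ext w; simp [rightIdeal]⟩

theorem IsFGRightIdeal.principal {n : ℕ} (w : Str n) : IsFGRightIdeal {v | ∃ u, v = w * u} :=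
  ⟨{w}, Set.finite_singleton _, by ext v; simp [rightIdeal]⟩

theorem IsFGRightIdeal.mul_right {n : ℕ} {R : Set (Str n)} (h : IsFGRightIdeal R)
    {w : Str n} (hw : w ∈ R) (u : Str n) : w * u ∈ R := by
  obtain ⟨X, -, rfl⟩ := h
  obtain ⟨x, hx, v, rfl⟩ := hw
  exact ⟨x, hx, v * u, mul_assoc _ _ _⟩

theorem IsFGRightIdeal.biUnion {n : ℕ} {ι : Type} {I : Set ι} (hI : I.Finite)
    {R : ι → Set (Str n)} (h : ∀ i ∈ I, IsFGRightIdeal (R i)) :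
    IsFGRightIdeal {w | ∃ i ∈ I, w ∈ R i} := by
  choose! X hX hR using h
  refine ⟨⋃ i ∈ I, X i, hI.biUnion hX, ?_⟩
  ext w
  constructor
  · rintro ⟨i, hi, hw⟩
    rw [hR i hi] at hw
    obtain ⟨x, hx, u, rfl⟩ := hw
    exact ⟨x, Set.mem_biUnion hi hx, u, rfl⟩
  · rintro ⟨x, hx, u, rfl⟩
    simp only [Set.mem_iUnion] at hx
    obtain ⟨i, hi, hx⟩ := hx
    refine ⟨i, hi, ?_⟩
    rw [hR i hi]
    exact ⟨x, hx, u, rfl⟩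

theorem IsFGRightIdeal.translate {n : ℕ} {R : Set (Str n)} (h : IsFGRightIdeal R) (x : Str n) :
    IsFGRightIdeal {w | ∃ u ∈ R, w = x * u} := by
  obtain ⟨X, hX, rfl⟩ := h
  refine ⟨(fun y => x * y) '' X, hX.image _, ?_⟩
  ext w
  constructor
  · rintro ⟨_, ⟨y, hy, v, rfl⟩, rfl⟩
    exact ⟨_, ⟨y, hy, rfl⟩, v, (mul_assoc _ _ _).symm⟩
  · rintro ⟨_, ⟨y, hy, rfl⟩, v, rfl⟩
    exact ⟨y * v, ⟨y, hy, v, rfl⟩, mul_assoc _ _ _⟩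

theorem str_mul_eq_mul {n : ℕ} {y u z t : Str n} (h : y * u = z * t) :
    (∃ s, z = y * s) ∨ ∃ s, y = z * s := by
  have h' : FreeMonoid.toList y ++ FreeMonoid.toList u
      = FreeMonoid.toList z ++ FreeMonoid.toList t := h
  rcases List.append_eq_append_iff.1 h' with ⟨s, hs, -⟩ | ⟨s, hs, -⟩
  · exact Or.inl ⟨FreeMonoid.ofList s, hs⟩
  · exact Or.inr ⟨FreeMonoid.ofList s, hs⟩

theorem IsFGRightIdeal.residual {n : ℕ} {R : Set (Str n)} (h : IsFGRightIdeal R) (y : Str n) :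
    IsFGRightIdeal {u | y * u ∈ R} := by
  obtain ⟨Z, hZ, rfl⟩ := h
  have := IsFGRightIdeal.biUnion hZ (R := fun z => {u | ∃ t, y * u = z * t}) (fun z _ => by
    by_cases h1 : ∃ s, y = z * s
    · obtain ⟨s, rfl⟩ := h1
      convert IsFGRightIdeal.univ (n := n)
      simp [mul_assoc]
    by_cases h2 : ∃ s, z = y * s
    · obtain ⟨s, rfl⟩ := h2
      have : {u | ∃ t, y * u = y * s * t} = {u | ∃ t, u = s * t} := by
        ext u
        simp [mul_assoc]
      rw [this]
      exact IsFGRightIdeal.principal s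
    convert IsFGRightIdeal.empty (n := n)
    ext u
    refine iff_of_false ?_ (Set.notMem_empty u)
    rintro ⟨t, ht⟩
    rcases str_mul_eq_mul ht with h | h
    · exact h2 h
    · exact h1 h)
  exact this

theorem mem_comp {n : ℕ} {f g : Str n →. Str n} {w y : Str n} :
    y ∈ f.comp g w ↔ ∃ z ∈ g w, y ∈ f z :=
  Part.mem_bind_iff (f := g w) (g := fun z => f z)

/-- `M_n`: all surjective morphisms between finitely generated right ideals of the free monoid,
together with the empty function, as partial functions (`Dom` is the domain, `ran` the image). -/
@[ext] structure M (n : ℕ) where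
  toPFun : Str n →. Str n
  dom_fg : IsFGRightIdeal toPFun.Dom
  ran_fg : IsFGRightIdeal toPFun.ran
  map_mul : ∀ r s y, y ∈ toPFun r → y * s ∈ toPFun (r * s)

theorem ran_fg_of {n : ℕ} {f : Str n →. Str n} (hd : IsFGRightIdeal f.Dom)
    (hm : ∀ r s y, y ∈ f r → y * s ∈ f (r * s)) : IsFGRightIdeal f.ran := by
  obtain ⟨X, hX, hd⟩ := hd
  have hfin : (f.image X).Finite := by
    have : f.image X ⊆ ⋃ x ∈ X, {y | y ∈ f x} := by
      intro y hy
      obtain ⟨x, hx, h⟩ := hy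
      exact Set.mem_biUnion hx h
    refine (hX.biUnion fun x _ => ?_).subset this
    exact Set.Subsingleton.finite fun a ha b hb => Part.mem_unique ha hb
  refine ⟨_, hfin, ?_⟩
  ext y
  constructor
  · rintro ⟨w, hw⟩
    have : w ∈ f.Dom := (PFun.mem_dom _ _).2 ⟨y, hw⟩
    rw [hd] at this
    obtain ⟨x, hx, u, rfl⟩ := this
    have hxd : x ∈ f.Dom := by
      rw [hd]; exact ⟨x, hx, 1, (mul_one x).symm⟩
    obtain ⟨z, hz⟩ := (PFun.mem_dom _ _).1 hxd
    exact ⟨z, ⟨x, hx, hz⟩, u, Part.mem_unique hw (hm _ _ _ hz)⟩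
  · rintro ⟨z, ⟨x, hx, hz⟩, u, rfl⟩
    exact ⟨x * u, hm _ _ _ hz⟩

namespace M

variable {n : ℕ}

theorem ext_mem {f g : M n} (h : ∀ w y, y ∈ f.toPFun w ↔ y ∈ g.toPFun w) : f = g :=
  M.ext (PFun.ext h)

/-- The identity function on a finitely generated right ideal. -/
def idOn (R : Set (Str n)) (hR : IsFGRightIdeal R) : M n where
  toPFun := PFun.res id R
  dom_fg := hR
  ran_fg := by
    convert hR
    ext y
    simp [PFun.ran, PFun.mem_res]
  map_mul := by
    intro r s y h
    rw [PFun.mem_res] at h ⊢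
    exact ⟨hR.mul_right h.1 s, by rw [← h.2]; rfl⟩

theorem mem_idOn {R : Set (Str n)} {hR : IsFGRightIdeal R} {w y : Str n} :
    y ∈ (idOn R hR).toPFun w ↔ w ∈ R ∧ w = y := PFun.mem_res _ _ _ _

/-- The product of `M_n` is composition of partial functions: `(f * g) w = f (g w)`. -/
instance : Mul (M n) where
  mul f g :=
    have hm : ∀ r s y, y ∈ (f.toPFun.comp g.toPFun) r → y * s ∈ (f.toPFun.comp g.toPFun) (r * s) := by
      intro r s y h
      rw [mem_comp] at h ⊢
      obtain ⟨z, hz, hy⟩ := h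
      exact ⟨z * s, g.map_mul _ _ _ hz, f.map_mul _ _ _ hy⟩
    have hd : IsFGRightIdeal (f.toPFun.comp g.toPFun).Dom := by
      obtain ⟨X, hX, hg⟩ := g.dom_fg
      have hx : ∀ x, ∃ y, x ∈ X → y ∈ g.toPFun x := by
        intro x
        by_cases hx : x ∈ X
        · have : x ∈ g.toPFun.Dom := by rw [hg]; exact ⟨x, hx, 1, (mul_one x).symm⟩
          obtain ⟨y, hy⟩ := (PFun.mem_dom _ _).1 this
          exact ⟨y, fun _ => hy⟩
        · exact ⟨1, fun h => absurd h hx⟩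
      choose y hy using hx
      convert IsFGRightIdeal.biUnion hX
        (R := fun x => {w | ∃ u ∈ {u | y x * u ∈ f.toPFun.Dom}, w = x * u})
        (fun x _ => (f.dom_fg.residual (y x)).translate x)
      ext w
      rw [PFun.mem_dom]
      simp only [mem_comp]
      constructor
      · rintro ⟨v, z, hz, hv⟩
        have : w ∈ g.toPFun.Dom := (PFun.mem_dom _ _).2 ⟨z, hz⟩
        rw [hg] at this
        obtain ⟨x, hx, u, rfl⟩ := this
        refine ⟨x, hx, u, (PFun.mem_dom _ _).2 ⟨v, ?_⟩, rfl⟩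
        rwa [Part.mem_unique (g.map_mul x u _ (hy x hx)) hz]
      · rintro ⟨x, hx, u, hu, rfl⟩
        obtain ⟨v, hv⟩ := (PFun.mem_dom _ _).1 hu
        exact ⟨v, _, g.map_mul x u _ (hy x hx), hv⟩
    ⟨f.toPFun.comp g.toPFun, hd, ran_fg_of hd hm, hm⟩

theorem mem_mul {f g : M n} {w y : Str n} :
    y ∈ (f * g).toPFun w ↔ ∃ z ∈ g.toPFun w, y ∈ f.toPFun z := mem_comp

instance : One (M n) := ⟨idOn Set.univ IsFGRightIdeal.univ⟩

theorem mem_one {w y : Str n} : y ∈ (1 : M n).toPFun w ↔ w = y := by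
  change y ∈ (idOn _ _).toPFun w ↔ _
  simp [mem_idOn]

/-- The empty function. -/
instance : Zero (M n) := ⟨idOn ∅ IsFGRightIdeal.empty⟩

theorem notMem_zero {w y : Str n} : ¬ y ∈ (0 : M n).toPFun w := by
  change ¬ y ∈ (idOn _ _).toPFun w
  simp [mem_idOn]

instance : Monoid (M n) where
  mul_assoc f g h := ext_mem fun w y => by
    simp only [mem_mul]
    exact ⟨fun ⟨z, hz, t, ht, hy⟩ => ⟨t, ⟨z, hz, ht⟩, hy⟩,
      fun ⟨t, ⟨z, hz, ht⟩, hy⟩ => ⟨z, hz, t, ht, hy⟩⟩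
  one_mul f := ext_mem fun w y => by simp [mem_mul, mem_one]
  mul_one f := ext_mem fun w y => by simp [mem_mul, mem_one]

theorem ne_zero_iff {f : M n} : f ≠ 0 ↔ ∃ w y, y ∈ f.toPFun w := by
  constructor
  · intro h
    by_contra! hc
    exact h (ext_mem fun w y => iff_of_false (hc w y) notMem_zero)
  · rintro ⟨w, y, h⟩ rfl
    exact notMem_zero h

/-- `f^*`: the identity function on the domain of `f`. -/
def star (f : M n) : M n := idOn f.toPFun.Dom f.dom_fg

theorem mem_star {f : M n} {w y : Str n} :
    y ∈ f.star.toPFun w ↔ (∃ z, z ∈ f.toPFun w) ∧ w = y := by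
  rw [star, mem_idOn, PFun.mem_dom]

/-- The natural partial order of the restriction monoid `M_n`: `a ≤ b` iff `a = b a^*`. -/
instance : LE (M n) := ⟨fun a b => a = b * a.star⟩

theorem le_def {a b : M n} : a ≤ b ↔ a = b * a.star := Iff.rfl

theorem le_iff {a b : M n} : a ≤ b ↔ ∀ w y, y ∈ a.toPFun w → y ∈ b.toPFun w := by
  rw [le_def]
  constructor
  · intro h w y hy
    rw [h, mem_mul] at hy
    obtain ⟨z, hz, hy⟩ := hy
    rw [mem_star] at hz
    rwa [hz.2]
  · intro h
    refine ext_mem fun w y => ?_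
    simp only [mem_mul, mem_star]
    constructor
    · exact fun hy => ⟨w, ⟨⟨y, hy⟩, rfl⟩, h w y hy⟩
    · rintro ⟨z, ⟨⟨t, ht⟩, rfl⟩, hy⟩
      rwa [Part.mem_unique hy (h _ _ ht)]

/-- The relation `≡`: below every nonzero `x ≤ a` there is a nonzero element that is also below
`b`, and conversely. -/
def equiv (a b : M n) : Prop :=
  (∀ x, x ≠ 0 → x ≤ a → ∃ z, z ≠ 0 ∧ z ≤ x ∧ z ≤ b) ∧
    ∀ y, y ≠ 0 → y ≤ b → ∃ z, z ≠ 0 ∧ z ≤ y ∧ z ≤ a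

theorem half_iff {a b : M n} : (∀ x, x ≠ 0 → x ≤ a → ∃ z, z ≠ 0 ∧ z ≤ x ∧ z ≤ b) ↔
    ∀ w y, y ∈ a.toPFun w → ∃ u z, z ∈ a.toPFun (w * u) ∧ z ∈ b.toPFun (w * u) := by
  constructor
  · intro h w y hy
    obtain ⟨z, hz0, hza, hzb⟩ := h (a * idOn _ (IsFGRightIdeal.principal w))
      (ne_zero_iff.2 ⟨w, y, mem_mul.2 ⟨w, mem_idOn.2 ⟨⟨1, (mul_one w).symm⟩, rfl⟩, hy⟩⟩)
      (le_iff.2 fun v t ht => by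
        obtain ⟨s, hs, ht⟩ := mem_mul.1 ht
        rwa [(mem_idOn.1 hs).2])
    obtain ⟨v, t, ht⟩ := ne_zero_iff.1 hz0
    obtain ⟨s, hs, ht'⟩ := mem_mul.1 (le_iff.1 hza v t ht)
    obtain ⟨⟨u, rfl⟩, rfl⟩ := mem_idOn.1 hs
    exact ⟨u, t, ht', le_iff.1 hzb _ _ ht⟩
  · intro h x hx0 hx
    obtain ⟨w, y, hy⟩ := ne_zero_iff.1 hx0
    obtain ⟨u, z, hza, hzb⟩ := h w y (le_iff.1 hx _ _ hy)
    have hzx : z ∈ x.toPFun (w * u) := by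
      have := x.map_mul _ u _ hy
      rwa [Part.mem_unique hza (le_iff.1 hx _ _ this)]
    refine ⟨x * idOn _ (IsFGRightIdeal.principal (w * u)), ne_zero_iff.2 ⟨w * u, z,
      mem_mul.2 ⟨_, mem_idOn.2 ⟨⟨1, (mul_one _).symm⟩, rfl⟩, hzx⟩⟩, ?_, ?_⟩
    · refine le_iff.2 fun v t ht => ?_
      obtain ⟨s, hs, ht⟩ := mem_mul.1 ht
      rwa [(mem_idOn.1 hs).2]
    · refine le_iff.2 fun v t ht => ?_
      obtain ⟨s, hs, ht⟩ := mem_mul.1 ht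
      obtain ⟨⟨r, rfl⟩, rfl⟩ := mem_idOn.1 hs
      have h1 := b.map_mul _ r _ hzb
      rwa [Part.mem_unique ht (x.map_mul _ r _ hzx)]

theorem equiv_iff {a b : M n} : equiv a b ↔
    (∀ w y, y ∈ a.toPFun w → ∃ u z, z ∈ a.toPFun (w * u) ∧ z ∈ b.toPFun (w * u)) ∧
    ∀ w y, y ∈ b.toPFun w → ∃ u z, z ∈ b.toPFun (w * u) ∧ z ∈ a.toPFun (w * u) :=
  and_congr half_iff half_iff

theorem le_trans' {a b c : M n} (h : a ≤ b) (k : b ≤ c) : a ≤ c :=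
  le_iff.2 fun w y hy => le_iff.1 k w y (le_iff.1 h w y hy)

/-- `≡` as a congruence on the monoid `M_n`. -/
def lenz (n : ℕ) : Con (M n) where
  r := equiv
  iseqv :=
    { refl := fun a => ⟨fun x h k => ⟨x, h, le_iff.2 fun _ _ h => h, k⟩,
        fun x h k => ⟨x, h, le_iff.2 fun _ _ h => h, k⟩⟩
      symm := fun h => ⟨h.2, h.1⟩
      trans := by
        intro a b c h k
        constructor
        · intro x hx hxa
          obtain ⟨z, hz, hzx, hzb⟩ := h.1 x hx hxa
          obtain ⟨t, ht, htz, htc⟩ := k.1 z hz hzb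
          exact ⟨t, ht, le_trans' htz hzx, htc⟩
        · intro x hx hxa
          obtain ⟨z, hz, hzx, hzb⟩ := k.2 x hx hxa
          obtain ⟨t, ht, htz, htc⟩ := h.2 z hz hzb
          exact ⟨t, ht, le_trans' htz hzx, htc⟩ }
  mul' := by
    have key : ∀ a b c d : M n, equiv a b → equiv c d → ∀ w y, y ∈ (a * c).toPFun w →
        ∃ u z, z ∈ (a * c).toPFun (w * u) ∧ z ∈ (b * d).toPFun (w * u) := by
      intro a b c d hab hcd w y hy
      obtain ⟨v, hv, hy⟩ := mem_mul.1 hy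
      obtain ⟨u, z, hz1, hz2⟩ := (equiv_iff.1 hcd).1 _ _ hv
      have hzv : z = v * u := Part.mem_unique hz1 (c.map_mul _ u _ hv)
      subst hzv
      obtain ⟨s, t, ht1, ht2⟩ := (equiv_iff.1 hab).1 _ _ (a.map_mul _ u _ hy)
      refine ⟨u * s, t, ?_, ?_⟩
      · rw [← mul_assoc]
        exact mem_mul.2 ⟨_, c.map_mul _ s _ hz1, ht1⟩
      · rw [← mul_assoc]
        exact mem_mul.2 ⟨_, d.map_mul _ s _ hz2, ht2⟩
    intro a b c d hab hcd
    exact equiv_iff.2 ⟨key _ _ _ _ hab hcd, key _ _ _ _ ⟨hab.2, hab.1⟩ ⟨hcd.2, hcd.1⟩⟩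

theorem lenz_iff {a b : M n} : lenz n a b ↔ equiv a b := Iff.rfl

theorem equiv_star {a b : M n} (h : equiv a b) : equiv a.star b.star := by
  have key : ∀ a b : M n, equiv a b → ∀ w y, y ∈ a.star.toPFun w →
      ∃ u z, z ∈ a.star.toPFun (w * u) ∧ z ∈ b.star.toPFun (w * u) := by
    intro a b h w y hy
    obtain ⟨⟨z, hz⟩, rfl⟩ := mem_star.1 hy
    obtain ⟨u, t, ht1, ht2⟩ := (equiv_iff.1 h).1 _ _ hz
    exact ⟨u, w * u, mem_star.2 ⟨⟨t, ht1⟩, rfl⟩, mem_star.2 ⟨⟨t, ht2⟩, rfl⟩⟩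
  exact equiv_iff.2 ⟨key _ _ h, key _ _ ⟨h.2, h.1⟩⟩

theorem star_star_mul (a b : M n) : (a.star * b).star = (a * b).star := by
  refine ext_mem fun w y => ?_
  simp only [mem_star, mem_mul]
  refine and_congr_left fun _ => ?_
  constructor
  · rintro ⟨_, v, hv, ⟨z, hz⟩, rfl⟩
    exact ⟨z, v, hv, hz⟩
  · rintro ⟨z, v, hv, hz⟩
    exact ⟨v, v, hv, ⟨z, hz⟩, rfl⟩

theorem star_one : (1 : M n).star = 1 := by
  refine ext_mem fun w y => ?_
  simp [mem_star, mem_one]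

theorem equiv_star_one_iff {a : M n} :
    equiv a.star 1 ↔ ∀ w, ∃ u y, y ∈ a.toPFun (w * u) := by
  rw [equiv_iff]
  simp only [mem_star, mem_one]
  constructor
  · rintro ⟨-, h⟩ w
    obtain ⟨u, z, -, ⟨y, hy⟩, -⟩ := h w w rfl
    exact ⟨u, y, hy⟩
  · intro h
    constructor
    · rintro w y ⟨⟨z, hz⟩, rfl⟩
      exact ⟨1, w, ⟨⟨z, by simpa using hz⟩, by simp⟩, by simp⟩
    · rintro w y rfl
      obtain ⟨u, y, hy⟩ := h w
      exact ⟨u, w * u, rfl, ⟨y, hy⟩, rfl⟩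

/-- The element `y ε⁻¹` of `M_n`, that is, the function `w ↦ y w`. -/
def prepend (y : Str n) : M n :=
  have hm : ∀ r s z, z ∈ PFun.lift (fun w => y * w) r →
      z * s ∈ PFun.lift (fun w => y * w) (r * s) := by
    intro r s z h
    rw [PFun.coe_val, Part.mem_some_iff] at h ⊢
    rw [h, mul_assoc]
  have hd : IsFGRightIdeal (PFun.lift (fun w : Str n => y * w)).Dom := by
    rw [PFun.dom_coe]; exact IsFGRightIdeal.univ
  ⟨PFun.lift fun w => y * w, hd, ran_fg_of hd hm, hm⟩

theorem mem_prepend {y w z : Str n} : z ∈ (prepend y).toPFun w ↔ z = y * w := by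
  change z ∈ PFun.lift _ w ↔ _
  rw [PFun.coe_val, Part.mem_some_iff]

theorem equiv_star_prepend (y : Str n) : equiv (prepend y).star 1 :=
  equiv_star_one_iff.2 fun w => ⟨1, y * (w * 1), mem_prepend.2 rfl⟩

/-- The operation `λ` on `M_n`: the union of the functions `f_i a_i⁻¹`, that is, the function that
sends `a_i u` to `f_i u` and is undefined at the empty string. -/
def lam (f : Fin n → M n) : M n :=
  let F : Str n →. Str n := fun w =>
    FreeMonoid.casesOn w Part.none fun i u => (f i).toPFun u
  have hm : ∀ r s y, y ∈ F r → y * s ∈ F (r * s) := by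
    intro r s y h
    induction r using FreeMonoid.casesOn with
    | one => exact absurd h (Part.notMem_none _)
    | of_mul i u => exact (f i).map_mul u s y h
  have hd : IsFGRightIdeal F.Dom := by
    convert IsFGRightIdeal.biUnion (Set.finite_univ (α := Fin n))
      (R := fun i => {w | ∃ u ∈ (f i).toPFun.Dom, w = FreeMonoid.of i * u})
      (fun i _ => (f i).dom_fg.translate _)
    ext w
    rw [PFun.mem_dom]
    induction w using FreeMonoid.casesOn with
    | one =>
      refine iff_of_false (fun ⟨y, hy⟩ => absurd hy (Part.notMem_none _)) ?_
      rintro ⟨i, -, u, -, h⟩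
      exact absurd h (List.cons_ne_nil i u).symm
    | of_mul i u =>
      constructor
      · rintro ⟨y, hy⟩
        exact ⟨i, trivial, u, (PFun.mem_dom _ _).2 ⟨y, hy⟩, rfl⟩
      · rintro ⟨j, -, v, hv, h⟩
        obtain ⟨rfl, rfl⟩ := List.cons.inj h
        exact (PFun.mem_dom _ _).1 hv
  ⟨F, hd, ran_fg_of hd hm, hm⟩

theorem mem_lam_of_mul {f : Fin n → M n} {i : Fin n} {u y : Str n} :
    y ∈ (lam f).toPFun (FreeMonoid.of i * u) ↔ y ∈ (f i).toPFun u := Iff.rfl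

theorem notMem_lam_one {f : Fin n → M n} {y : Str n} : ¬ y ∈ (lam f).toPFun 1 :=
  Part.notMem_none y

theorem mem_lam {f : Fin n → M n} {w y : Str n} :
    y ∈ (lam f).toPFun w ↔ ∃ i, ∃ u, w = FreeMonoid.of i * u ∧ y ∈ (f i).toPFun u := by
  constructor
  · intro h
    induction w using FreeMonoid.casesOn with
    | one => exact absurd h notMem_lam_one
    | of_mul i u => exact ⟨i, u, rfl, h⟩
  · rintro ⟨i, u, rfl, h⟩
    exact h

theorem equiv_lam {f g : Fin n → M n} (h : ∀ i, equiv (f i) (g i)) : equiv (lam f) (lam g) := by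
  have key : ∀ f g : Fin n → M n, (∀ i, equiv (f i) (g i)) → ∀ w y, y ∈ (lam f).toPFun w →
      ∃ u z, z ∈ (lam f).toPFun (w * u) ∧ z ∈ (lam g).toPFun (w * u) := by
    intro f g h w y hy
    obtain ⟨i, v, rfl, hy⟩ := mem_lam.1 hy
    obtain ⟨u, z, h1, h2⟩ := (equiv_iff.1 (h i)).1 _ _ hy
    exact ⟨u, z, h1, h2⟩
  exact equiv_iff.2 ⟨key _ _ h, key _ _ fun i => ⟨(h i).2, (h i).1⟩⟩

end M

/-- The monoid `𝒞_n = M_n / ≡`. -/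
abbrev C (n : ℕ) : Type := (M.lenz n).Quotient

namespace C

variable {n : ℕ}

/-- The class of an element of `M_n`. -/
def mk (f : M n) : C n := (f : (M.lenz n).Quotient)

theorem mk_eq {f g : M n} : mk f = mk g ↔ M.equiv f g := (M.lenz n).eq

theorem mk_mul (f g : M n) : mk (f * g) = mk f * mk g := rfl

theorem mk_out (c : C n) : mk (Quotient.out c) = c := Quotient.out_eq c

/-- `[f]^* = [f^*]`. -/
def star (c : C n) : C n :=
  Quotient.liftOn c (fun f => mk f.star) fun _ _ h => mk_eq.2 (M.equiv_star h)

theorem star_mk (f : M n) : star (mk f) = mk f.star := rfl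

/-- `([f_1], …, [f_n])λ = [(f_1, …, f_n)λ]`; independent of representatives by `lam_mk`. -/
def lam (c : Fin n → C n) : C n := mk (M.lam fun i => Quotient.out (c i))

theorem lam_mk (f : Fin n → M n) : lam (fun i => mk (f i)) = mk (M.lam f) :=
  mk_eq.2 (M.equiv_lam fun i => mk_eq.1 (mk_out (mk (f i))))

/-- `[f]α_i = [f ρ_{a_i}]`, where `ρ_{a_i}` is `w ↦ a_i w`. -/
def alpha (i : Fin n) (c : C n) : C n := c * mk (M.prepend (FreeMonoid.of i))

end C

/-- `𝒯_n`: the submonoid of total maps of `𝒞_n`, the elements `c` with `c^* = 1`. -/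
def T (n : ℕ) : Submonoid (C n) where
  carrier := {c | c.star = 1}
  one_mem' := congrArg C.mk M.star_one
  mul_mem' := by
    rintro a b ha hb
    obtain ⟨f, rfl⟩ : ∃ f, C.mk f = a := ⟨_, C.mk_out a⟩
    obtain ⟨g, rfl⟩ : ∃ g, C.mk g = b := ⟨_, C.mk_out b⟩
    change C.mk f.star = 1 at ha
    change C.mk g.star = 1 at hb
    change C.mk (f * g).star = 1
    rw [← M.star_star_mul, ← C.star_mk, C.mk_mul, ha, one_mul]
    exact hb

theorem mk_mem_T {n : ℕ} {f : M n} : C.mk f ∈ T n ↔ ∀ w, ∃ u y, y ∈ f.toPFun (w * u) :=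
  C.mk_eq.trans M.equiv_star_one_iff

/-- An `n`-ary Cantor algebra `(X, α_1, …, α_n, λ)`. -/
class CantorAlgebra (n : ℕ) (X : Type*) where
  alpha : Fin n → X → X
  lam : (Fin n → X) → X
  lam_alpha : ∀ x, lam (fun i => alpha i x) = x
  alpha_lam : ∀ (x : Fin n → X) (i : Fin n), alpha i (lam x) = x i

/-- The automorphism group of an `n`-ary Cantor algebra: the permutations that preserve all the
operations, under composition. -/
def CantorAlgebra.Aut (n : ℕ) (X : Type*) [CantorAlgebra n X] : Subgroup (Equiv.Perm X) where
  carrier := {φ | (∀ (i : Fin n) (x : X), φ (alpha i x) = alpha i (φ x)) ∧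
    ∀ x : Fin n → X, φ (lam x) = lam fun i => φ (x i)}
  one_mem' := ⟨fun _ _ => rfl, fun _ => rfl⟩
  mul_mem' := by
    rintro a b ⟨ha1, ha2⟩ ⟨hb1, hb2⟩
    exact ⟨fun i x => by simp [ha1, hb1], fun x => by simp [ha2, hb2]⟩
  inv_mem' := by
    rintro a ⟨ha1, ha2⟩
    refine ⟨fun i x => ?_, fun x => ?_⟩
    · rw [Equiv.Perm.inv_eq_iff_eq, ha1]
      simp
    · rw [Equiv.Perm.inv_eq_iff_eq, ha2]
      simp

theorem C.alpha_mem_T {n : ℕ} (i : Fin n) {c : C n} (hc : c ∈ T n) : c.alpha i ∈ T n :=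
  (T n).mul_mem hc (C.mk_eq.2 (M.equiv_star_prepend _))

theorem C.lam_mem_T {n : ℕ} [n.AtLeastTwo] {c : Fin n → C n} (hc : ∀ i, c i ∈ T n) :
    C.lam c ∈ T n := by
  refine mk_mem_T.2 fun w => ?_
  have hc' : ∀ i, ∀ w, ∃ u y, y ∈ (Quotient.out (c i)).toPFun (w * u) := fun i =>
    mk_mem_T.1 (by rw [C.mk_out]; exact hc i)
  induction w using FreeMonoid.casesOn with
  | one =>
    have i : Fin n := ⟨0, by have := Nat.AtLeastTwo.prop (n := n); omega⟩
    obtain ⟨u, y, hy⟩ := hc' i 1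
    exact ⟨FreeMonoid.of i * u, y, hy⟩
  | of_mul i v =>
    obtain ⟨u, y, hy⟩ := hc' i v
    exact ⟨u, y, hy⟩

theorem C.lam_alpha {n : ℕ} [n.AtLeastTwo] (c : C n) : C.lam (fun i => c.alpha i) = c := by
  obtain ⟨f, rfl⟩ : ∃ f, C.mk f = c := ⟨_, C.mk_out c⟩
  have i₀ : Fin n := ⟨0, by have := Nat.AtLeastTwo.prop (n := n); omega⟩
  refine (C.lam_mk fun i => f * M.prepend (FreeMonoid.of i)).trans (C.mk_eq.2 ?_)
  have hm : ∀ (i : Fin n) (u y : Str n),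
      y ∈ (M.lam fun i => f * M.prepend (FreeMonoid.of i)).toPFun (FreeMonoid.of i * u) ↔
        y ∈ f.toPFun (FreeMonoid.of i * u) := by
    intro i u y
    rw [M.mem_lam_of_mul, M.mem_mul]
    simp [M.mem_prepend]
  refine M.equiv_iff.2 ⟨fun w y hy => ?_, fun w y hy => ?_⟩
  · obtain ⟨i, u, rfl, -⟩ := M.mem_lam.1 hy
    exact ⟨1, y, by simpa using hy, by simpa using (hm i u y).1 hy⟩
  · induction w using FreeMonoid.casesOn with
    | one =>
      have h := f.map_mul _ (FreeMonoid.of i₀) _ hy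
      refine ⟨FreeMonoid.of i₀, _, h, ?_⟩
      have := (hm i₀ 1 (y * FreeMonoid.of i₀)).2
      simp only [mul_one, one_mul] at this h ⊢
      exact this h
    | of_mul i u => exact ⟨1, y, by simpa using hy, by simpa using (hm i u y).2 hy⟩

theorem C.alpha_lam {n : ℕ} (c : Fin n → C n) (i : Fin n) : (C.lam c).alpha i = c i := by
  obtain ⟨f, rfl⟩ : ∃ f : Fin n → M n, (fun i => C.mk (f i)) = c :=
    ⟨fun i => Quotient.out (c i), funext fun i => C.mk_out _⟩
  rw [C.lam_mk]
  refine congrArg C.mk (M.ext_mem (f := M.lam f * M.prepend (FreeMonoid.of i)) fun w y => ?_)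
  simp [M.mem_mul, M.mem_prepend, M.mem_lam_of_mul]

/-- The `n`-ary Cantor algebra `𝒯_n`. -/
instance {n : ℕ} [n.AtLeastTwo] : CantorAlgebra n (T n) where
  alpha i c := ⟨c.1.alpha i, C.alpha_mem_T i c.2⟩
  lam c := ⟨C.lam fun i => (c i).1, C.lam_mem_T fun i => (c i).2⟩
  lam_alpha c := Subtype.ext (C.lam_alpha c.1)
  alpha_lam c i := Subtype.ext (C.alpha_lam (fun i => (c i).1) i)

/-- `D_n`: the bijective morphisms between finitely generated right ideals of the free monoid
(including the empty function), a submonoid of `M_n`. -/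
def D (n : ℕ) : Submonoid (M n) where
  carrier := {f | ∀ v w y, y ∈ f.toPFun v → y ∈ f.toPFun w → v = w}
  one_mem' := by
    intro v w y hv hw
    rw [M.mem_one] at hv hw
    rw [hv, hw]
  mul_mem' := by
    intro a b ha hb v w y hv hw
    obtain ⟨s, hs, hv⟩ := M.mem_mul.1 hv
    obtain ⟨t, ht, hw⟩ := M.mem_mul.1 hw
    have := ha _ _ _ hv hw
    subst this
    exact hb _ _ _ hs ht

namespace D

variable {n : ℕ}

/-- The empty function. -/
instance : Zero (D n) := ⟨⟨0, fun _ _ _ h => absurd h M.notMem_zero⟩⟩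

theorem ne_zero_iff {f : D n} : f ≠ 0 ↔ ∃ w y, y ∈ f.1.toPFun w := by
  rw [← M.ne_zero_iff, Ne, Ne, Subtype.ext_iff]
  rfl

/-- The inverse partial bijection. -/
instance : Inv (D n) where
  inv f :=
    let F : Str n →. Str n := fun y => ⟨∃ w, y ∈ f.1.toPFun w, fun h => h.choose⟩
    have hF : ∀ y w, w ∈ F y ↔ y ∈ f.1.toPFun w := by
      intro y w
      constructor
      · rintro ⟨h, rfl⟩
        exact h.choose_spec
      · intro h
        have h' : ∃ w, y ∈ f.1.toPFun w := ⟨w, h⟩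
        exact ⟨h', f.2 _ _ _ h'.choose_spec h⟩
    ⟨{ toPFun := F
       dom_fg := f.1.ran_fg
       ran_fg := by
        convert f.1.dom_fg
        ext w
        rw [PFun.mem_dom]
        exact exists_congr fun y => hF y w
       map_mul := fun r s y h => (hF _ _).2 (f.1.map_mul _ _ _ ((hF _ _).1 h)) },
      fun v w y hv hw => Part.mem_unique ((hF _ _).1 hv) ((hF _ _).1 hw)⟩

theorem mem_inv {f : D n} {y w : Str n} : w ∈ (f⁻¹).1.toPFun y ↔ y ∈ f.1.toPFun w := by
  constructor
  · rintro ⟨h, rfl⟩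
    exact h.choose_spec
  · intro h
    have h' : ∃ w, y ∈ f.1.toPFun w := ⟨w, h⟩
    exact ⟨h', f.2 _ _ _ h'.choose_spec h⟩

theorem mem_mul {f g : D n} {w y : Str n} :
    y ∈ (f * g).1.toPFun w ↔ ∃ z ∈ g.1.toPFun w, y ∈ f.1.toPFun z := M.mem_mul

theorem ext_mem {f g : D n} (h : ∀ w y, y ∈ f.1.toPFun w ↔ y ∈ g.1.toPFun w) : f = g :=
  Subtype.ext (M.ext_mem h)

theorem inv_inv (f : D n) : f⁻¹⁻¹ = f := ext_mem fun w y => by rw [mem_inv, mem_inv]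

theorem mem_inv_mul {f : D n} {w y : Str n} :
    y ∈ (f⁻¹ * f).1.toPFun w ↔ (∃ z, z ∈ f.1.toPFun w) ∧ w = y := by
  rw [mem_mul]
  constructor
  · rintro ⟨z, hz, hy⟩
    exact ⟨⟨z, hz⟩, f.2 _ _ _ hz (mem_inv.1 hy)⟩
  · rintro ⟨⟨z, hz⟩, rfl⟩
    exact ⟨z, hz, mem_inv.2 hz⟩

theorem mem_mul_inv {f : D n} {w y : Str n} :
    y ∈ (f * f⁻¹).1.toPFun w ↔ (∃ z, w ∈ f.1.toPFun z) ∧ w = y := by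
  have := mem_inv_mul (f := f⁻¹) (w := w) (y := y)
  rw [inv_inv] at this
  simpa only [mem_inv] using this

/-- Essential idempotents: the nonzero idempotents `e` with `e f ≠ 0` for every nonzero
idempotent `f`. -/
def IsEssentialIdem (e : D n) : Prop :=
  e * e = e ∧ e ≠ 0 ∧ ∀ f : D n, f * f = f → f ≠ 0 → e * f ≠ 0

/-- Essential elements: `𝐝(a) = a⁻¹a` and `𝐫(a) = aa⁻¹` are essential idempotents. -/
def IsEssential (a : D n) : Prop := IsEssentialIdem (a⁻¹ * a) ∧ IsEssentialIdem (a * a⁻¹)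

theorem isEssentialIdem_inv_mul {a : D n} :
    IsEssentialIdem (a⁻¹ * a) ↔ ∀ w, ∃ u y, y ∈ a.1.toPFun (w * u) := by
  constructor
  · intro h w
    let e : D n := ⟨M.idOn _ (IsFGRightIdeal.principal w), fun s t y hs ht => by
      rw [(M.mem_idOn.1 hs).2, (M.mem_idOn.1 ht).2]⟩
    have he : ∀ s t, t ∈ e.1.toPFun s ↔ (∃ u, s = w * u) ∧ s = t := fun s t => M.mem_idOn
    obtain ⟨v, y, hy⟩ := ne_zero_iff.1 (h.2.2 e
      (ext_mem fun s t => by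
        rw [mem_mul]
        simp only [he]
        exact ⟨fun ⟨z, ⟨_, h1⟩, h2⟩ => h1 ▸ h2, fun h => ⟨s, ⟨h.1, rfl⟩, h⟩⟩)
      (ne_zero_iff.2 ⟨w, w, (he _ _).2 ⟨⟨1, (mul_one w).symm⟩, rfl⟩⟩))
    obtain ⟨z, hz, hy⟩ := mem_mul.1 hy
    obtain ⟨⟨u, rfl⟩, rfl⟩ := (he _ _).1 hz
    obtain ⟨⟨t, ht⟩, -⟩ := mem_inv_mul.1 hy
    exact ⟨u, t, ht⟩
  · intro h
    refine ⟨ext_mem fun w y => ?_, ne_zero_iff.2 ?_, fun f hf h0 => ne_zero_iff.2 ?_⟩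
    · rw [mem_mul]
      simp only [mem_inv_mul]
      exact ⟨fun ⟨z, ⟨_, h1⟩, h2⟩ => h1 ▸ h2, fun h => ⟨w, ⟨h.1, rfl⟩, h⟩⟩
    · obtain ⟨u, y, hy⟩ := h 1
      exact ⟨1 * u, 1 * u, mem_inv_mul.2 ⟨⟨y, hy⟩, rfl⟩⟩
    · obtain ⟨w, z, hz⟩ := ne_zero_iff.1 h0
      obtain ⟨u, y, hy⟩ := h z
      exact ⟨w * u, z * u, mem_mul.2 ⟨z * u, f.1.map_mul _ u _ hz, mem_inv_mul.2 ⟨⟨y, hy⟩, rfl⟩⟩⟩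

theorem isEssential_iff {a : D n} : IsEssential a ↔
    (∀ w, ∃ u y, y ∈ a.1.toPFun (w * u)) ∧ ∀ w, ∃ u v, w * u ∈ a.1.toPFun v := by
  refine and_congr isEssentialIdem_inv_mul ?_
  have := isEssentialIdem_inv_mul (a := a⁻¹)
  rw [inv_inv] at this
  simpa only [mem_inv] using this

theorem IsEssential.inv {a : D n} (h : IsEssential a) : IsEssential a⁻¹ := by
  rw [IsEssential, inv_inv]
  exact ⟨h.2, h.1⟩

end D

/-- `D_n^e`: the essential elements of `D_n`. -/
def De (n : ℕ) : Submonoid (D n) where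
  carrier := {a | D.IsEssential a}
  one_mem' := D.isEssential_iff.2
    ⟨fun w => ⟨1, w * 1, M.mem_one.2 rfl⟩, fun w => ⟨1, w * 1, M.mem_one.2 rfl⟩⟩
  mul_mem' := by
    intro a b ha hb
    replace ha := D.isEssential_iff.1 ha
    replace hb := D.isEssential_iff.1 hb
    refine D.isEssential_iff.2 ?_
    constructor
    · intro w
      obtain ⟨u, z, hz⟩ := hb.1 w
      obtain ⟨s, y, hy⟩ := ha.1 z
      refine ⟨u * s, y, ?_⟩
      rw [← mul_assoc]
      exact D.mem_mul.2 ⟨_, b.1.map_mul _ s _ hz, hy⟩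
    · intro w
      obtain ⟨u, v, hv⟩ := ha.2 w
      obtain ⟨s, t, ht⟩ := hb.2 v
      refine ⟨u * s, t, ?_⟩
      rw [← mul_assoc]
      exact D.mem_mul.2 ⟨_, ht, a.1.map_mul _ s _ hv⟩

namespace De

variable {n : ℕ}

instance : Inv (De n) := ⟨fun a => ⟨a.1⁻¹, D.IsEssential.inv a.2⟩⟩

/-- The natural partial order of the inverse monoid `D_n^e`: `a ≤ b` iff `a = b a⁻¹ a`. -/
instance : LE (De n) := ⟨fun a b => a = b * a⁻¹ * a⟩

theorem le_iff {a b : De n} : a ≤ b ↔ ∀ w y, y ∈ a.1.1.toPFun w → y ∈ b.1.1.toPFun w := by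
  change a = b * a⁻¹ * a ↔ _
  rw [mul_assoc]
  have key : ∀ w y, y ∈ (b * (a⁻¹ * a)).1.1.toPFun w ↔
      (∃ z, z ∈ a.1.1.toPFun w) ∧ y ∈ b.1.1.toPFun w := by
    intro w y
    refine D.mem_mul.trans ?_
    change (∃ z ∈ (a.1⁻¹ * a.1).1.toPFun w, _) ↔ _
    simp only [D.mem_inv_mul]
    exact ⟨fun ⟨z, ⟨h1, h2⟩, h3⟩ => ⟨h1, h2 ▸ h3⟩, fun ⟨h1, h2⟩ => ⟨w, ⟨h1, rfl⟩, h2⟩⟩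
  constructor
  · intro h w y hy
    rw [h] at hy
    exact ((key _ _).1 hy).2
  · intro h
    refine Subtype.ext (D.ext_mem fun w y => ?_)
    rw [key]
    exact ⟨fun hy => ⟨⟨y, hy⟩, h _ _ hy⟩,
      fun ⟨⟨z, hz⟩, hy⟩ => by rwa [Part.mem_unique hy (h _ _ hz)]⟩

/-- The minimum group congruence `σ` on `D_n^e`: `a σ b` iff some `c` lies below both. -/
def sigma (n : ℕ) : Con (De n) where
  r a b := ∃ c : De n, c ≤ a ∧ c ≤ b
  iseqv :=
    { refl := fun a => ⟨a, le_iff.2 fun _ _ h => h, le_iff.2 fun _ _ h => h⟩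
      symm := fun ⟨c, h, k⟩ => ⟨c, k, h⟩
      trans := by
        rintro a b c ⟨s, hsa, hsb⟩ ⟨t, htb, htc⟩
        rw [le_iff] at hsa hsb htb htc
        have key : ∀ w y, y ∈ (s * (t⁻¹ * t)).1.1.toPFun w →
            y ∈ s.1.1.toPFun w ∧ y ∈ t.1.1.toPFun w := by
          intro w y hy
          obtain ⟨z, hz, hy⟩ := D.mem_mul.1 hy
          obtain ⟨⟨v, hv⟩, rfl⟩ := D.mem_inv_mul.1 hz
          refine ⟨hy, ?_⟩
          rwa [Part.mem_unique (hsb _ _ hy) (htb _ _ hv)]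
        exact ⟨s * (t⁻¹ * t), le_iff.2 fun w y hy => hsa _ _ (key w y hy).1,
          le_iff.2 fun w y hy => htc _ _ (key w y hy).2⟩ }
  mul' := by
    rintro a b c d ⟨s, hsa, hsb⟩ ⟨t, htc, htd⟩
    rw [le_iff] at hsa hsb htc htd
    refine ⟨s * t, le_iff.2 fun w y hy => ?_, le_iff.2 fun w y hy => ?_⟩
    · obtain ⟨z, hz, hy⟩ := D.mem_mul.1 hy
      exact D.mem_mul.2 ⟨z, htc _ _ hz, hsa _ _ hy⟩
    · obtain ⟨z, hz, hy⟩ := D.mem_mul.1 hy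
      exact D.mem_mul.2 ⟨z, htd _ _ hz, hsb _ _ hy⟩

theorem inv_le_inv {a b : De n} (h : a ≤ b) : a⁻¹ ≤ b⁻¹ :=
  le_iff.2 fun _ _ hy => D.mem_inv.2 (le_iff.1 h _ _ (D.mem_inv.1 hy))

end De

/-- The Thompson group `G_{n,1} = D_n^e / σ`. -/
abbrev ThompsonGroup (n : ℕ) : Type := (De.sigma n).Quotient

instance (n : ℕ) : Group (ThompsonGroup n) :=
  { (inferInstance : Monoid (De.sigma n).Quotient) with
    inv := Quotient.map (fun a : De n => a⁻¹) fun _ _ ⟨c, h, k⟩ =>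
      ⟨c⁻¹, De.inv_le_inv h, De.inv_le_inv k⟩
    inv_mul_cancel := by
      intro g
      induction g using Con.induction_on with
      | H a =>
        refine (De.sigma n).eq.2 ⟨a⁻¹ * a, De.le_iff.2 fun _ _ h => h, De.le_iff.2 fun w y h => ?_⟩
        obtain ⟨-, rfl⟩ := D.mem_inv_mul.1 h
        exact M.mem_one.2 rfl }

/-- The class in `G_{n,1}` of an element of `D_n^e`. -/
def De.toThompson {n : ℕ} (d : De n) : ThompsonGroup n := (d : (De.sigma n).Quotient)

/-- The `≡`-class of an element of `D_n^e ⊆ M_n`, an element of `𝒯_n`. -/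
def De.toT {n : ℕ} (d : De n) : T n :=
  ⟨C.mk d.1.1, mk_mem_T.2 (D.isEssential_iff.1 d.2).1⟩

end CantorThompson

end

/-!
Elements of `𝒯_n` are germs of right-ideal morphisms defined on an essential (dense) right ideal,
and they are determined by their products with the translations `ρ_w : u ↦ w u` for `w` in any
dense set (`C.eq_of_mul_prepend_eq`).

An automorphism `φ` of the Cantor algebra commutes with the `α_i`, hence with right multiplication
by every `ρ_w`. If `f` sends `w` to `y`, then `f ρ_w = ρ_y`, so that
`φ(f) ρ_w = φ(ρ_y) = φ(1) ρ_y = φ(1) f ρ_w`. As the domain of `f` is dense, `φ(f) = φ(1) f`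
(`T.aut_apply`). The same holds for `φ⁻¹`, so `φ(1)` is a unit. Conversely, left multiplication
always respects the operations. Hence the automorphism group is the group of units of `𝒯_n`
(`T.unitsEquivAut`).

It remains to identify the units with the Thompson group (`De.thompsonEquivUnits`). By cancellation
in the free monoid, any `f ≡ 1` is an actual restriction of the identity
(`M.eq_of_mem_of_equiv_one`). Therefore an element of `D_n^e` with trivial class lies below `1`,
which gives injectivity. If `[f]` and `[k]` are mutually inverse, then `k f` and `f k` are partial
identities, so the restriction `f (k f)` of `f` is injective, with dense domain and dense image:
this is a representative of `[f]` in `D_n^e`, which gives surjectivity.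
-/

namespace CantorThompson

namespace M

variable {n : ℕ}

/-- Restricting to an essential right ideal does not change the `≡`-class. -/
theorem equiv_of_le_of_dense {a b : M n} (h : a ≤ b)
    (hd : ∀ w, ∃ u y, y ∈ a.toPFun (w * u)) : equiv a b := by
  rw [le_iff] at h
  refine equiv_iff.2 ⟨fun w y hy => ⟨1, y, ?_, ?_⟩, fun w y _ => ?_⟩
  · rwa [mul_one]
  · rw [mul_one]
    exact h w y hy
  · obtain ⟨u, z, hz⟩ := hd w
    exact ⟨u, z, h _ _ hz, hz⟩

theorem eq_of_mem_of_equiv_one {f : M n} (h : equiv f 1) {w y : Str n} (hy : y ∈ f.toPFun w) :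
    y = w := by
  obtain ⟨u, z, hz, h1⟩ := (equiv_iff.1 h).1 w y hy
  rw [mem_one] at h1
  subst h1
  exact mul_right_cancel (Part.mem_unique (f.map_mul w u y hy) hz)

theorem mul_lam (g : M n) (f : Fin n → M n) : g * lam f = lam fun i => g * f i := by
  refine ext_mem fun w y => ?_
  simp only [mem_mul, mem_lam]
  constructor
  · rintro ⟨z, ⟨i, u, rfl, hz⟩, hy⟩
    exact ⟨i, u, rfl, z, hz, hy⟩
  · rintro ⟨i, u, rfl, z, hz, hy⟩
    exact ⟨z, ⟨i, u, rfl, hz⟩, hy⟩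

theorem prepend_one : prepend (1 : Str n) = 1 :=
  ext_mem fun w y => by rw [mem_prepend, mem_one, one_mul, eq_comm]

theorem prepend_mul (v w : Str n) : prepend (v * w) = prepend v * prepend w :=
  ext_mem fun u y => by simp [mem_mul, mem_prepend, mul_assoc]

theorem mul_prepend_of_mem {f : M n} {w y : Str n} (h : y ∈ f.toPFun w) :
    f * prepend w = prepend y := by
  refine ext_mem fun u z => ?_
  have hu := f.map_mul w u y h
  simp only [mem_mul, mem_prepend, exists_eq_left]
  exact ⟨fun hz => Part.mem_unique hz hu, fun hz => hz ▸ hu⟩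

end M

namespace C

variable {n : ℕ}

theorem mul_lam (c : C n) (f : Fin n → C n) : c * lam f = lam fun i => c * f i := by
  obtain ⟨g, rfl⟩ : ∃ g, mk g = c := ⟨_, mk_out c⟩
  obtain ⟨f, rfl⟩ : ∃ f' : Fin n → M n, (fun i => mk (f' i)) = f :=
    ⟨fun i => Quotient.out (f i), funext fun i => mk_out _⟩
  rw [lam_mk, ← mk_mul, M.mul_lam]
  exact (lam_mk _).symm

/-- The translations `u ↦ w u`, for `w` in a dense set of strings, are jointly epimorphic. -/
theorem eq_of_mul_prepend_eq {a b : C n} {R : Set (Str n)} (hR : ∀ w, ∃ u, w * u ∈ R)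
    (h : ∀ w ∈ R, a * mk (M.prepend w) = b * mk (M.prepend w)) : a = b := by
  have key : ∀ f g : M n, (∀ w ∈ R, mk f * mk (M.prepend w) = mk g * mk (M.prepend w)) →
      ∀ w y, y ∈ f.toPFun w → ∃ u z, z ∈ f.toPFun (w * u) ∧ z ∈ g.toPFun (w * u) := by
    intro f g h w y hy
    obtain ⟨u, hu⟩ := hR w
    have he : M.equiv (f * M.prepend (w * u)) (g * M.prepend (w * u)) := mk_eq.1 (h _ hu)
    obtain ⟨v, z, h1, h2⟩ := (M.equiv_iff.1 he).1 1 (y * u) (M.mem_mul.2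
      ⟨w * u, M.mem_prepend.2 (mul_one _).symm, f.map_mul w u y hy⟩)
    simp only [M.mem_mul, M.mem_prepend, exists_eq_left, one_mul, mul_assoc] at h1 h2
    exact ⟨u * v, z, h1, h2⟩
  obtain ⟨f, rfl⟩ : ∃ f, mk f = a := ⟨_, mk_out a⟩
  obtain ⟨g, rfl⟩ : ∃ g, mk g = b := ⟨_, mk_out b⟩
  exact mk_eq.2 (M.equiv_iff.2 ⟨key f g h, key g f fun w hw => (h w hw).symm⟩)

end C

namespace T

variable {n : ℕ}

/-- The class in `𝒯_n` of the translation `u ↦ w u`. -/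
def prepend (w : Str n) : T n := ⟨C.mk (M.prepend w), C.mk_eq.2 (M.equiv_star_prepend w)⟩

theorem prepend_one : prepend (1 : Str n) = 1 :=
  Subtype.ext (congrArg C.mk M.prepend_one)

theorem prepend_mul (v w : Str n) : prepend (v * w) = prepend v * prepend w :=
  Subtype.ext (congrArg C.mk (M.prepend_mul v w))

variable [n.AtLeastTwo]

theorem alpha_eq_mul_prepend (i : Fin n) (f : T n) :
    CantorAlgebra.alpha i f = f * prepend (FreeMonoid.of i) := rfl

theorem mul_lam (g : T n) (f : Fin n → T n) :
    g * CantorAlgebra.lam f = CantorAlgebra.lam fun i => g * f i :=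
  Subtype.ext (C.mul_lam g.1 fun i => (f i).1)

theorem aut_mul_prepend {φ : Equiv.Perm (T n)} (hφ : φ ∈ CantorAlgebra.Aut n (T n)) (f : T n)
    (w : Str n) : φ (f * prepend w) = φ f * prepend w := by
  induction w using FreeMonoid.inductionOn' generalizing f with
  | one => rw [prepend_one, mul_one, mul_one]
  | of_mul i w ih =>
    rw [prepend_mul, ← mul_assoc, ih, ← alpha_eq_mul_prepend, hφ.1, alpha_eq_mul_prepend,
      mul_assoc]

/-- Every automorphism of the Cantor algebra `𝒯_n` is left multiplication by the image of `1`: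
both sides agree after composition with the translations by the strings in the domain of `f`. -/
theorem aut_apply {φ : Equiv.Perm (T n)} (hφ : φ ∈ CantorAlgebra.Aut n (T n)) (f : T n) :
    φ f = φ 1 * f := by
  obtain ⟨c, hc⟩ := f
  obtain ⟨f, rfl⟩ : ∃ f, C.mk f = c := ⟨_, C.mk_out c⟩
  refine Subtype.ext (C.eq_of_mul_prepend_eq (R := {w | ∃ y, y ∈ f.toPFun w})
    (mk_mem_T.1 hc) ?_)
  rintro w ⟨y, hy⟩
  have hfw : (⟨C.mk f, hc⟩ : T n) * prepend w = prepend y :=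
    Subtype.ext (congrArg C.mk (M.mul_prepend_of_mem hy))
  have h : φ ⟨C.mk f, hc⟩ * prepend w = φ 1 * ⟨C.mk f, hc⟩ * prepend w := by
    rw [← aut_mul_prepend hφ, mul_assoc, hfw, ← aut_mul_prepend hφ, one_mul]
  exact congrArg Subtype.val h

/-- Left multiplication by units, as a homomorphism into the automorphism group. -/
def mulLeftAut (n : ℕ) [n.AtLeastTwo] : (T n)ˣ →* CantorAlgebra.Aut n (T n) where
  toFun g := ⟨g.mulLeft, fun i f => (mul_assoc (g : T n) f (prepend (FreeMonoid.of i))).symm,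
    fun f => mul_lam _ f⟩
  map_one' := Subtype.ext (Equiv.ext fun f => one_mul f)
  map_mul' g h := Subtype.ext (Equiv.ext fun f => mul_assoc (g : T n) h f)

theorem mulLeftAut_apply (g : (T n)ˣ) (f : T n) :
    (mulLeftAut n g : Equiv.Perm (T n)) f = g * f := rfl

theorem mulLeftAut_bijective : Function.Bijective (mulLeftAut n) := by
  constructor
  · intro g h hgh
    have := congrArg (fun φ : CantorAlgebra.Aut n (T n) => (φ : Equiv.Perm (T n)) 1) hgh
    simpa only [mulLeftAut_apply, mul_one, Units.val_inj] using this
  · rintro ⟨φ, hφ⟩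
    refine ⟨⟨φ 1, φ⁻¹ 1, ?_, ?_⟩, Subtype.ext (Equiv.ext fun f => (aut_apply hφ f).symm)⟩
    · exact (aut_apply hφ _).symm.trans (φ.apply_symm_apply 1)
    · exact (aut_apply (inv_mem hφ) _).symm.trans (φ.symm_apply_apply 1)

/-- The automorphism group of the Cantor algebra `𝒯_n` is the group of units of the monoid `𝒯_n`,
acting by left multiplication. -/
noncomputable def unitsEquivAut (n : ℕ) [n.AtLeastTwo] : (T n)ˣ ≃* CantorAlgebra.Aut n (T n) :=
  MulEquiv.ofBijective (mulLeftAut n) mulLeftAut_bijective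

end T

namespace De

variable {n : ℕ}

/-- `De.toT` as a monoid homomorphism. -/
def toTHom (n : ℕ) : De n →* T n where
  toFun := toT
  map_one' := rfl
  map_mul' _ _ := rfl

theorem toT_eq_of_le {a b : De n} (h : a ≤ b) : toT a = toT b :=
  Subtype.ext (C.mk_eq.2
    (M.equiv_of_le_of_dense (M.le_iff.2 (le_iff.1 h)) (D.isEssential_iff.1 a.2).1))

/-- The homomorphism `G_{n,1} → 𝒯_n` induced by `d ↦ [d]`. -/
def thompsonToT (n : ℕ) : ThompsonGroup n →* T n :=
  (sigma n).lift (toTHom n) fun _ _ ⟨_, ha, hb⟩ => (toT_eq_of_le ha).symm.trans (toT_eq_of_le hb)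

theorem thompsonToT_toHomUnits_injective :
    Function.Injective (thompsonToT n).toHomUnits := by
  rw [injective_iff_map_eq_one]
  intro g hg
  induction g using Con.induction_on with
  | H d =>
    have hd : toT d = 1 := congrArg Units.val hg
    have he : M.equiv d.1.1 1 := C.mk_eq.1 (congrArg Subtype.val hd)
    exact (sigma n).eq.2 ⟨d, le_iff.2 fun _ _ h => h,
      le_iff.2 fun w y hy => M.mem_one.2 (M.eq_of_mem_of_equiv_one he hy).symm⟩

/-- Two morphisms that are mutually inverse up to `≡` have a common bijective core: the restriction
`f (k f)` of `f` to the domain of `k f` is an essential element of `D_n`. -/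
theorem exists_toT_eq_mk {f k : M n} (hf : ∀ w, ∃ u y, y ∈ f.toPFun (w * u))
    (hk : ∀ w, ∃ u y, y ∈ k.toPFun (w * u)) (hfk : M.equiv (f * k) 1) (hkf : M.equiv (k * f) 1) :
    ∃ d : De n, (toT d : C n) = C.mk f := by
  have hmem : ∀ w y, y ∈ (f * (k * f)).toPFun w ↔ y ∈ f.toPFun w ∧ w ∈ k.toPFun y := by
    intro w y
    constructor
    · intro h
      obtain ⟨v, hv, hy⟩ := M.mem_mul.1 h
      obtain rfl := M.eq_of_mem_of_equiv_one hkf hv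
      obtain ⟨z, hz, hv⟩ := M.mem_mul.1 hv
      rw [Part.mem_unique hy hz]
      exact ⟨hz, hv⟩
    · rintro ⟨h1, h2⟩
      exact M.mem_mul.2 ⟨w, M.mem_mul.2 ⟨y, h1, h2⟩, h1⟩
  have hdom : ∀ w, ∃ u y, y ∈ (f * (k * f)).toPFun (w * u) := by
    intro w
    obtain ⟨u, y, hy⟩ := hf w
    obtain ⟨s, v, hv⟩ := hk y
    have hy' := f.map_mul _ s _ hy
    obtain rfl := M.eq_of_mem_of_equiv_one hkf (M.mem_mul.2 ⟨_, hy', hv⟩)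
    rw [mul_assoc] at hy' hv
    exact ⟨u * s, y * s, (hmem _ _).2 ⟨hy', hv⟩⟩
  have hran : ∀ w, ∃ u v, w * u ∈ (f * (k * f)).toPFun v := by
    intro w
    obtain ⟨u, v, hv⟩ := hk w
    obtain ⟨s, y, hy⟩ := hf v
    have hv' := k.map_mul _ s _ hv
    obtain rfl := M.eq_of_mem_of_equiv_one hfk (M.mem_mul.2 ⟨_, hv', hy⟩)
    rw [mul_assoc] at hy hv'
    exact ⟨u * s, v * s, (hmem _ _).2 ⟨hy, hv'⟩⟩
  let d : D n := ⟨f * (k * f), fun v w y hv hw =>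
    Part.mem_unique ((hmem v y).1 hv).2 ((hmem w y).1 hw).2⟩
  exact ⟨⟨d, D.isEssential_iff.2 ⟨hdom, hran⟩⟩, C.mk_eq.2
    (M.equiv_of_le_of_dense (M.le_iff.2 fun w y h => ((hmem w y).1 h).1) hdom)⟩

theorem thompsonToT_toHomUnits_surjective :
    Function.Surjective (thompsonToT n).toHomUnits := by
  rintro ⟨⟨a, ha⟩, ⟨b, hb⟩, hab, hba⟩
  obtain ⟨f, rfl⟩ : ∃ f, C.mk f = a := ⟨_, C.mk_out a⟩
  obtain ⟨k, rfl⟩ : ∃ k, C.mk k = b := ⟨_, C.mk_out b⟩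
  obtain ⟨d, hd⟩ := exists_toT_eq_mk (mk_mem_T.1 ha) (mk_mem_T.1 hb)
    (C.mk_eq.1 (congrArg Subtype.val hab)) (C.mk_eq.1 (congrArg Subtype.val hba))
  exact ⟨toThompson d, Units.ext (Subtype.ext hd)⟩

/-- The Thompson group `G_{n,1}` is the group of units of `𝒯_n`, via `σ(d) ↦ [d]`. -/
noncomputable def thompsonEquivUnits (n : ℕ) : ThompsonGroup n ≃* (T n)ˣ :=
  MulEquiv.ofBijective (thompsonToT n).toHomUnits
    ⟨thompsonToT_toHomUnits_injective, thompsonToT_toHomUnits_surjective⟩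

end De

end CantorThompson

theorem mainTheorem4 (n : ℕ) [n.AtLeastTwo] :
    (∃ Φ : CantorThompson.ThompsonGroup n ≃* CantorThompson.CantorAlgebra.Aut n (CantorThompson.T n),
      ∀ (d : CantorThompson.De n) (f : CantorThompson.T n),
        (Φ (CantorThompson.De.toThompson d) : Equiv.Perm (CantorThompson.T n)) f = CantorThompson.De.toT d * f) ∧
    (∀ g : (CantorThompson.T n)ˣ,
      ∃ φ ∈ CantorThompson.CantorAlgebra.Aut n (CantorThompson.T n),
        ∀ f : CantorThompson.T n, φ f = g * f) ∧
    (∀ φ ∈ CantorThompson.CantorAlgebra.Aut n (CantorThompson.T n),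
      ∃ g : (CantorThompson.T n)ˣ, ∀ f : CantorThompson.T n, φ f = g * f) := by
  refine ⟨⟨(CantorThompson.De.thompsonEquivUnits n).trans (CantorThompson.T.unitsEquivAut n),
    fun _ _ => rfl⟩, fun g => ⟨_, (CantorThompson.T.mulLeftAut n g).2, fun _ => rfl⟩,
    fun φ hφ => ?_⟩
  obtain ⟨g, hg⟩ := CantorThompson.T.mulLeftAut_bijective.2 ⟨φ, hφ⟩
  refine ⟨g, fun f => ?_⟩
  rw [← CantorThompson.T.mulLeftAut_apply, hg]
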